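/- All communication is one-way with public coins: the two players share a random source, the first player sends a single message of $s$ bits, and the second player then outputs an answer. A protocol has failure probability at most $\delta$ if on every input pair allowed by the promise the output is wrong with probability at most $\delta$. $\mathbf{R}^{\rightarrow,pub}_\delta(f)$ is the least $s$ for which $f$ has such a protocol. $\mathbf{UR}_k^{\subset}$ (on $n$ bits): Alice gets $x\in\{0,1\}^n$; Bob gets $y\in\{0,1\}^n$ and $\|x\|_0$, with the promise $\mathrm{support}(y)\subsetneq\mathrm{support}(x)$. Bob must output $\min\{k,\|x-y\|_0\}$ distinct indices $i$ with $x_i\ne y_i$. $\mathbf{AugIndex}_N$: Charlie gets $z\in\{0,1\}^N$; Diane gets $j^*\in[N]$ and $z_{j^*+1},\dots,z_N$, and must output $z_{j^*}$. Write $X=X(n,k)=k\log_2^2(n/k)$. **Theorem.** There are absolute constants $c_1,c_2>0$ such that for all integers $1\le k\le n$ there is an integer $N$ with $c_1X\le N\le\lceil c_2X\rceil$ (that is, $N=\Theta(k\log^2(n/k))$ up to rounding) and $$\mathbf{R}^{\rightarrow,pub}_{1/5}(\mathbf{UR}_k^{\subset})\ \ge\ \mathbf{R}^{\rightarrow,pub}_{1/3}(\mathbf{AugIndex}_N).$$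 Moreover the inequality comes from a single-query reduction. There are maps, depending only on $n,k$, that turn Charlie's input into an input for Alice, Diane's input into an input for Bob, and Diane's input together with Bob's output into a bit, and that send every allowed $\mathbf{AugIndex}_N$ input pair to an allowed $\mathbf{UR}_k^{\subset}$ input pair, such that the following holds. For every $s$-bit protocol for $\mathbf{UR}_k^{\subset}$ with failure probability at most $1/5$ there is an $s$-bit protocol $\mathcal P'$ for $\mathbf{UR}_k^{\subset}$ with failure probability at most $1/5$ in which, on every allowed input pair, all sets of $\min\{k,\|x-y\|_0\}$ indices on which $x,y$ differ are equally likely to be output; and the $s$-bit protocol in which Charlie sends Alice's $\mathcal P'$-message for his encoded input, and Diane decodes the output of Bob in $\mathcal P'$ on her encoded input, solves $\mathbf{AugIndex}_N$ with failure probability at most $1/3$. **Corollary.** There is an absolute constant $c>0$ such that for all integers $1\le k\le n$, $\ \mathbf{R}^{\rightarrow,pub}_{1/5}(\mathbf{UR}_k^{\subset})\ge c\cdot\min\{n,\ k\log_2^2(n/k)\}$. -/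

import Mathlib

open MeasureTheory

/-- A one-way communication problem: Alice and Bob each hold an input (the pair obeys a promise),
and Bob has to produce a correct output. -/
structure OneWayProblem where
  AliceInput : Type
  BobInput : Type
  Output : Type
  Promise : AliceInput → BobInput → Prop
  Correct : AliceInput → BobInput → Output → Prop

/-- A public-coin one-way protocol with an `s`-bit message. The public randomness is a point `ω` of
an arbitrary probability space; for each outcome, Alice maps her input to a string of `s` bits, and
Bob maps that string and his own input to an output. -/
structure OneWayProtocol (P : OneWayProblem) (s : ℕ) where
  Ω : Type
  [mΩ : MeasurableSpace Ω]
  μ : Measure Ω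
  [prob : IsProbabilityMeasure μ]
  alice : Ω → P.AliceInput → (Fin s → Bool)
  bob : Ω → (Fin s → Bool) → P.BobInput → P.Output
  measurable_alice : ∀ a m, MeasurableSet {ω | alice ω a = m}
  measurable_bob : ∀ m b (O : Set P.Output), MeasurableSet {ω | bob ω m b ∈ O}

namespace OneWayProtocol

attribute [instance] OneWayProtocol.mΩ OneWayProtocol.prob

variable {P Q : OneWayProblem} {s : ℕ}

/-- The output of the protocol on inputs `a`, `b` when the public randomness is `ω`. -/
def out (π : OneWayProtocol P s) (a : P.AliceInput) (b : P.BobInput) (ω : π.Ω) : P.Output :=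
  π.bob ω (π.alice ω a) b

/-- On every pair of inputs that obeys the promise, the protocol errs with probability at most
`δ`. -/
def FailsWithProbAtMost (π : OneWayProtocol P s) (δ : ℝ) : Prop :=
  ∀ a b, P.Promise a b → π.μ.real {ω | ¬ P.Correct a b (π.out a b ω)} ≤ δ

/-- On every pair of inputs that obeys the promise, all correct outputs are equally likely. -/
def IsSymmetrized (π : OneWayProtocol P s) : Prop :=
  ∀ a b, P.Promise a b → ∀ A B : P.Output, P.Correct a b A → P.Correct a b B →
    π.μ.real {ω | π.out a b ω = A} = π.μ.real {ω | π.out a b ω = B}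

end OneWayProtocol

/-- The randomized one-way public-coin communication complexity of `P` with failure probability `δ`:
the least number `s` of bits for which some protocol with an `s`-bit message fails with probability
at most `δ` on every input. -/
noncomputable def oneWayComplexity (δ : ℝ) (P : OneWayProblem) : ℕ :=
  sInf {s : ℕ | ∃ π : OneWayProtocol P s, π.FailsWithProbAtMost δ}

/-- How players for `Q` use a protocol for `P` once: Charlie turns his input into an input for
Alice, Diane turns hers into one input for Bob and reads her answer off Bob's output. Legitimate
instances of `Q` become legitimate instances of `P`. -/
structure SingleQuery (Q P : OneWayProblem) where
  encodeAlice : Q.AliceInput → P.AliceInput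
  encodeBob : Q.BobInput → P.BobInput
  decode : Q.BobInput → P.Output → Q.Output
  promise : ∀ a b, Q.Promise a b → P.Promise (encodeAlice a) (encodeBob b)

/-- The protocol for `Q` in which Charlie sends Alice's message and Diane queries Bob once. -/
def SingleQuery.protocol {Q P : OneWayProblem} (r : SingleQuery Q P) {s : ℕ}
    (π : OneWayProtocol P s) : OneWayProtocol Q s where
  Ω := π.Ω
  μ := π.μ
  alice ω a := π.alice ω (r.encodeAlice a)
  bob ω m b := r.decode b (π.bob ω m (r.encodeBob b))
  measurable_alice a m := π.measurable_alice (r.encodeAlice a) m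
  measurable_bob m b O := π.measurable_bob m (r.encodeBob b) (r.decode b ⁻¹' O)

/-- The support of a bit vector. -/
def bitSupport {n : ℕ} (x : Fin n → Bool) : Finset (Fin n) :=
  Finset.univ.filter fun i => x i = true

/-- The set of indices on which two bit vectors differ. -/
def diffIndices {n : ℕ} (x y : Fin n → Bool) : Finset (Fin n) :=
  Finset.univ.filter fun i => x i ≠ y i

/-- The universal relation problem with containment promise. Alice holds `x`; Bob holds `y` and the
number of ones of `x`; it is promised that the support of `y` is a proper subset of that of `x`.
Bob must output `min k ‖x - y‖₀` distinct indices on which `x` and `y` differ. -/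
def urSubset (n k : ℕ) : OneWayProblem where
  AliceInput := Fin n → Bool
  BobInput := (Fin n → Bool) × Fin (n + 1)
  Output := Finset (Fin n)
  Promise x b := bitSupport b.1 ⊂ bitSupport x ∧ (b.2 : ℕ) = (bitSupport x).card
  Correct x b A := A ⊆ diffIndices x b.1 ∧ A.card = min k (diffIndices x b.1).card

/-- Augmented indexing. Charlie holds `z`; Diane holds an index `j` and the bits of `z` after
position `j`, and must output `z j`. -/
def augIndex (N : ℕ) : OneWayProblem where
  AliceInput := Fin N → Bool
  BobInput := Σ j : Fin N, ({i : Fin N // j < i} → Bool)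
  Output := Bool
  Promise z b := ∀ i : {i : Fin N // b.1 < i}, b.2 i = z i
  Correct z b o := o = z b.1

/-- Sending `x` itself solves the problem without error, so the infimum in `oneWayComplexity` is over
a nonempty set. -/
theorem urSubset_solvable (n k : ℕ) :
    ∃ π : OneWayProtocol (urSubset n k) n, π.FailsWithProbAtMost 0 := by
  have h (x y : Fin n → Bool) : ∃ A : Finset (Fin n),
      A ⊆ diffIndices x y ∧ A.card = min k (diffIndices x y).card :=
    Finset.exists_subset_card_eq (min_le_right _ _)
  choose f hf using h
  refine ⟨{ Ω := Unit
            μ := Measure.dirac ()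
            alice := fun _ x => x
            bob := fun _ x b => f x b.1
            measurable_alice := fun _ _ => MeasurableSet.of_discrete
            measurable_bob := fun _ _ _ => MeasurableSet.of_discrete }, ?_⟩
  intro x b _
  have : {ω : Unit | ¬ (urSubset n k).Correct x b (f x b.1)} = ∅ := by
    ext ω
    simpa [urSubset] using hf x b.1
  exact (congrArg (Measure.dirac ()).real this).trans_le (by simp)

/-- Sending `z` itself solves the problem without error. -/
theorem augIndex_solvable (N : ℕ) :
    ∃ π : OneWayProtocol (augIndex N) N, π.FailsWithProbAtMost 0 := by
  refine ⟨{ Ω := Unit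
            μ := Measure.dirac ()
            alice := fun _ z => z
            bob := fun _ z b => z b.1
            measurable_alice := fun _ _ => MeasurableSet.of_discrete
            measurable_bob := fun _ _ _ => MeasurableSet.of_discrete }, ?_⟩
  intro z b _
  have : {ω : Unit | ¬ (augIndex N).Correct z b (z b.1)} = ∅ := by
    ext ω
    simp [augIndex]
  exact (congrArg (Measure.dirac ()).real this).trans_le (by simp)

/-! Conjugating a protocol by a shared random permutation of the coordinates keeps its failure
probability and makes Bob's correct outputs equally likely: under the containment promise `x` is 1
and `y` is 0 on all of their difference set, so permuting that set changes neither input.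

Charlie cuts his `T * L` bits into `T` blocks. Block `t` owns `W t` places for each of its `2 ^ L`
possible contents, and `x` marks the `W t` places of the actual content. Diane knows all blocks
after the block `t` of her bit, so her `y` marks these and the difference set consists of the blocks
up to `t`. Any differing index inside block `t` reveals its whole content. The weight of `x` is
always `∑ t, W t`, so Diane knows it too. It remains that a uniform correct output misses block `t`
with probability at most 1/8, since 1/5 + 1/8 ≤ 1/3.

For `n ≥ 16 * k` the sizes `W` grow by a factor 8 every `max 1 (k / 8)` blocks, so block `t` is
about a `1 / k` fraction or more of the blocks up to `t` (`admissibleBlocks_geometric`); with `q` of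
order `log (n / k)`, `q` size levels and `q` bits per block give order `k * q ^ 2` bits. For `n < 16
* k` at most `k` blocks of size 1 suffice, as Bob must then output every difference
(`admissibleBlocks_one`).

The corollary also needs a linear lower bound for augmented indexing (`augIndex_le_fifteen_mul`),
proved by weighting each string by `2 ^ (-errors)`. -/

namespace OneWayProtocol

variable {P : OneWayProblem} {s : ℕ}

theorem measurableSet_out (π : OneWayProtocol P s) (a : P.AliceInput) (b : P.BobInput)
    (O : Set P.Output) : MeasurableSet {ω | π.out a b ω ∈ O} := by
  have h : {ω | π.out a b ω ∈ O} =
      ⋃ m : Fin s → Bool, {ω | π.alice ω a = m} ∩ {ω | π.bob ω m b ∈ O} := by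
    ext ω
    simp [out]
  rw [h]
  exact MeasurableSet.iUnion fun m => (π.measurable_alice a m).inter (π.measurable_bob m b O)

theorem FailsWithProbAtMost.mono {π : OneWayProtocol P s} {δ ε : ℝ}
    (h : π.FailsWithProbAtMost δ) (hδ : δ ≤ ε) : π.FailsWithProbAtMost ε :=
  fun a b hab => (h a b hab).trans hδ

end OneWayProtocol

/-! ### Symmetrization by a random permutation -/

/-- The probability of an event in the product with a uniformly distributed element of a finite
type is the average of the probabilities of its sections. -/
theorem measureReal_prod_uniformOfFintype {Ω G : Type} [MeasurableSpace Ω] (μ : Measure Ω)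
    [IsProbabilityMeasure μ] [Fintype G] [Nonempty G] [MeasurableSpace G]
    [MeasurableSingletonClass G] {E : Set (Ω × G)} (hE : MeasurableSet E) :
    (μ.prod (PMF.uniformOfFintype G).toMeasure).real E =
      (∑ g, μ.real {ω | (ω, g) ∈ E}) / Fintype.card G := by
  rw [measureReal_def, Measure.prod_apply_symm hE, lintegral_fintype, ENNReal.toReal_sum,
    Finset.sum_div]
  · refine Finset.sum_congr rfl fun g _ => ?_
    rw [PMF.toMeasure_apply_singleton _ _ (measurableSet_singleton g)]
    simp [measureReal_def, div_eq_mul_inv, Set.preimage]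
  · intro g _
    exact ENNReal.mul_ne_top (measure_ne_top _ _) (measure_ne_top _ _)

theorem measurableSet_prod_of_sections {Ω G : Type} [MeasurableSpace Ω] [Countable G]
    [MeasurableSpace G] [MeasurableSingletonClass G] {E : Set (Ω × G)}
    (hE : ∀ g, MeasurableSet {ω | (ω, g) ∈ E}) : MeasurableSet E := by
  have h : E = ⋃ g : G, {ω | (ω, g) ∈ E} ×ˢ {g} := by
    ext ⟨ω, g⟩
    simp
  rw [h]
  exact MeasurableSet.iUnion fun g => (hE g).prod (measurableSet_singleton g)

theorem card_bitSupport_comp_perm {n : ℕ} (σ : Equiv.Perm (Fin n)) (x : Fin n → Bool) :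
    (bitSupport (x ∘ σ)).card = (bitSupport x).card := by
  refine Finset.card_equiv σ fun i => ?_
  simp [bitSupport]

theorem diffIndices_comp_perm {n : ℕ} (σ : Equiv.Perm (Fin n)) (x y : Fin n → Bool) :
    (diffIndices (x ∘ σ) (y ∘ σ)).map σ.toEmbedding = diffIndices x y := by
  ext i
  simp only [diffIndices, Finset.mem_map_equiv, Finset.mem_filter, Finset.mem_univ, true_and,
    Function.comp, Equiv.apply_symm_apply]

theorem urSubset_promise_comp_perm {n k : ℕ} (σ : Equiv.Perm (Fin n)) {x : Fin n → Bool}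
    {b : (Fin n → Bool) × Fin (n + 1)} (h : (urSubset n k).Promise x b) :
    (urSubset n k).Promise (x ∘ σ) (b.1 ∘ σ, b.2) := by
  obtain ⟨h₁, h₂⟩ := h
  refine ⟨?_, by rw [card_bitSupport_comp_perm]; exact h₂⟩
  rw [Finset.ssubset_iff_subset_ne] at h₁ ⊢
  refine ⟨fun i hi => ?_, fun he => h₁.2 ?_⟩
  · have := @h₁.1 (σ i)
    simp only [bitSupport, Finset.mem_filter, Finset.mem_univ, true_and, Function.comp] at this hi ⊢
    exact this hi
  · ext i
    have := Finset.ext_iff.1 he (σ.symm i)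
    simpa [bitSupport] using this

theorem urSubset_correct_comp_perm {n k : ℕ} (σ : Equiv.Perm (Fin n)) (x : Fin n → Bool)
    (b : (Fin n → Bool) × Fin (n + 1)) (A : Finset (Fin n)) :
    (urSubset n k).Correct x b (A.map σ.toEmbedding) ↔
      (urSubset n k).Correct (x ∘ σ) (b.1 ∘ σ, b.2) A := by
  have h := diffIndices_comp_perm σ x b.1
  simp only [urSubset]
  rw [← h, Finset.map_subset_map, Finset.card_map, Finset.card_map]

/-- Two subsets of equal size of `D` are exchanged by a permutation that fixes everything outside
of `D`. -/
theorem exists_perm_map_eq {α : Type*} [Fintype α] [DecidableEq α] {A B D : Finset α}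
    (hA : A ⊆ D) (hB : B ⊆ D) (hAB : A.card = B.card) :
    ∃ τ : Equiv.Perm α, A.map τ.toEmbedding = B ∧ (∀ i ∉ D, τ i = i) := by
  have key : ∀ C : Finset α, C ⊆ D → Fintype.card {i : D // i.1 ∈ C} = C.card := by
    intro C hC
    rw [← Fintype.card_coe]
    exact Fintype.card_congr
      ⟨fun i => ⟨i.1.1, i.2⟩, fun i => ⟨⟨i.1, hC i.2⟩, i.2⟩, fun _ => rfl, fun _ => rfl⟩
  let e : {i : D // i.1 ∈ A} ≃ {i : D // i.1 ∈ B} :=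
    Fintype.equivOfCardEq (by rw [key A hA, key B hB, hAB])
  refine ⟨Equiv.Perm.ofSubtype (p := (· ∈ D)) e.extendSubtype, ?_, fun i hi =>
    Equiv.Perm.ofSubtype_apply_of_not_mem _ hi⟩
  refine Finset.eq_of_subset_of_card_le (fun i hi => ?_) (by rw [Finset.card_map, hAB])
  obtain ⟨a, ha, rfl⟩ := Finset.mem_map.1 hi
  rw [Equiv.coe_toEmbedding, Equiv.Perm.ofSubtype_apply_of_mem _ (hA ha)]
  exact e.extendSubtype_mem ⟨a, hA ha⟩ ha

namespace OneWayProtocol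

/-- The protocol in which the players permute the coordinates by a shared uniformly random
permutation before running `π`. -/
noncomputable def symmetrize {n k s : ℕ} (π : OneWayProtocol (urSubset n k) s) :
    OneWayProtocol (urSubset n k) s :=
  letI : MeasurableSpace (Equiv.Perm (Fin n)) := ⊤
  { Ω := π.Ω × Equiv.Perm (Fin n)
    μ := π.μ.prod (PMF.uniformOfFintype (Equiv.Perm (Fin n))).toMeasure
    alice := fun ω (x : Fin n → Bool) => π.alice ω.1 (x ∘ ω.2)
    bob := fun ω m (b : (Fin n → Bool) × Fin (n + 1)) =>
      (π.bob ω.1 m (b.1 ∘ ω.2, b.2) : Finset (Fin n)).map ω.2.toEmbedding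
    measurable_alice := fun (x : Fin n → Bool) m =>
      measurableSet_prod_of_sections fun σ => π.measurable_alice (x ∘ σ) m
    measurable_bob := fun m (b : (Fin n → Bool) × Fin (n + 1)) O =>
      measurableSet_prod_of_sections fun σ =>
        π.measurable_bob m (b.1 ∘ σ, b.2) ((fun A : Finset (Fin n) => A.map σ.toEmbedding) ⁻¹' O) }

theorem measureReal_symmetrize_out {n k s : ℕ} (π : OneWayProtocol (urSubset n k) s)
    (x : Fin n → Bool) (b : (Fin n → Bool) × Fin (n + 1)) (O : Set (Finset (Fin n))) :
    π.symmetrize.μ.real {ω | π.symmetrize.out x b ω ∈ O} =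
      (∑ σ : Equiv.Perm (Fin n), π.μ.real {ω | Finset.map σ.toEmbedding
        (π.out (x ∘ σ : Fin n → Bool) (b.1 ∘ σ, b.2) ω : Finset (Fin n)) ∈ O}) /
          Fintype.card (Equiv.Perm (Fin n)) := by
  let : MeasurableSpace (Equiv.Perm (Fin n)) := ⊤
  exact measureReal_prod_uniformOfFintype π.μ (π.symmetrize.measurableSet_out x b O)

theorem failsWithProbAtMost_symmetrize {n k s : ℕ} {π : OneWayProtocol (urSubset n k) s} {δ : ℝ}
    (h : π.FailsWithProbAtMost δ) : π.symmetrize.FailsWithProbAtMost δ := by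
  intro x b hxb
  refine (measureReal_symmetrize_out π x b {A | ¬ (urSubset n k).Correct x b A}).trans_le ?_
  rw [div_le_iff₀ (by exact_mod_cast Fintype.card_pos), mul_comm, ← nsmul_eq_mul,
    ← Finset.card_univ]
  refine Finset.sum_le_card_nsmul _ _ _ fun σ _ => ?_
  refine (congrArg π.μ.real ?_).trans_le (h _ _ (urSubset_promise_comp_perm σ hxb))
  ext ω
  exact not_congr (urSubset_correct_comp_perm σ x b _)

/-- A permutation `τ` of the difference set carrying `A` to `B` fixes both inputs, so the
substitution `σ ↦ τ * σ` matches the runs that output `A` with those that output `B`. -/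
theorem isSymmetrized_symmetrize {n k s : ℕ} (π : OneWayProtocol (urSubset n k) s) :
    π.symmetrize.IsSymmetrized := by
  intro x b hxb A B hA hB
  obtain ⟨τ, hτ, hfix⟩ := exists_perm_map_eq hA.1 hB.1 (hA.2.trans hB.2.symm)
  refine (measureReal_symmetrize_out π x b {A}).trans
    (Eq.trans ?_ (measureReal_symmetrize_out π x b {B}).symm)
  have hD : ∀ i ∈ diffIndices x b.1, x i = true ∧ b.1 i = false := by
    intro i hi
    have h₁ := @hxb.1.1 i
    simp only [bitSupport, diffIndices, Finset.mem_filter, Finset.mem_univ, true_and] at h₁ hi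
    cases hx : x i <;> cases hb : b.1 i <;> simp_all
  -- If `τ i` were outside the difference set, `τ` would fix it, and injectivity would give `τ i =
  -- i`.
  have hτD : ∀ i ∈ diffIndices x b.1, τ i ∈ diffIndices x b.1 := by
    intro i hi
    by_contra hc
    exact hc ((τ.injective (hfix _ hc)).symm ▸ hi)
  have hx : ∀ i, x (τ i) = x i := by
    intro i
    by_cases hi : i ∈ diffIndices x b.1
    · rw [(hD i hi).1, (hD _ (hτD i hi)).1]
    · rw [hfix i hi]
  have hb : ∀ i, b.1 (τ i) = b.1 i := by
    intro i
    by_cases hi : i ∈ diffIndices x b.1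
    · rw [(hD i hi).2, (hD _ (hτD i hi)).2]
    · rw [hfix i hi]
  congr 1
  refine Fintype.sum_equiv (Equiv.mulLeft τ) _ _ fun σ => ?_
  have hmap : ∀ C : Finset (Fin n),
      C.map (τ * σ).toEmbedding = (C.map σ.toEmbedding).map τ.toEmbedding := by
    intro C
    rw [Finset.map_map]
    rfl
  have hxσ : (x ∘ (τ * σ : Equiv.Perm (Fin n)) : Fin n → Bool) = x ∘ σ :=
    funext fun i => hx (σ i)
  have hbσ : (b.1 ∘ (τ * σ : Equiv.Perm (Fin n)) : Fin n → Bool) = b.1 ∘ σ :=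
    funext fun i => hb (σ i)
  refine congrArg π.μ.real (Set.ext fun ω => ?_)
  change Finset.map σ.toEmbedding (π.out (x ∘ σ : Fin n → Bool) (b.1 ∘ σ, b.2) ω) = A ↔
    Finset.map (τ * σ).toEmbedding
      (π.out (x ∘ (τ * σ : Equiv.Perm (Fin n)) : Fin n → Bool)
        (b.1 ∘ (τ * σ : Equiv.Perm (Fin n)), b.2) ω) = B
  rw [hxσ, hbσ]
  generalize π.out (x ∘ σ : Fin n → Bool) (b.1 ∘ σ, b.2) ω = C
  have hC := hmap C
  constructor
  · intro h
    exact hC.trans ((congrArg (Finset.map τ.toEmbedding) h).trans hτ)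
  · intro h
    exact Finset.map_injective τ.toEmbedding (hC.symm.trans (h.trans hτ.symm))

end OneWayProtocol

/-! ### Probability that a uniform correct output misses a given set -/

/-- Sampling without replacement misses `W` of `M` elements no more often than sampling with
replacement: factor by factor, `(M - W - i) / (M - i) ≤ (M - W) / M`. -/
theorem Nat.choose_sub_mul_pow_le (M W k : ℕ) :
    (M - W).choose k * M ^ k ≤ M.choose k * (M - W) ^ k := by
  have h : ∀ k, (M - W).descFactorial k * M ^ k ≤ M.descFactorial k * (M - W) ^ k := by
    intro k
    induction k with
    | zero => simp
    | succ k ih =>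
      have h₁ : (M - W - k) * M ≤ (M - k) * (M - W) := by
        rw [Nat.sub_mul _ k, Nat.sub_mul _ k, mul_comm M (M - W)]
        exact Nat.sub_le_sub_left (Nat.mul_le_mul_left k (Nat.sub_le M W)) _
      calc (M - W).descFactorial (k + 1) * M ^ (k + 1)
          = ((M - W - k) * M) * ((M - W).descFactorial k * M ^ k) := by
            rw [Nat.descFactorial_succ]; ring
        _ ≤ ((M - k) * (M - W)) * (M.descFactorial k * (M - W) ^ k) := Nat.mul_le_mul h₁ ih
        _ = M.descFactorial (k + 1) * (M - W) ^ (k + 1) := by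
            rw [Nat.descFactorial_succ]; ring
  have h' := h k
  rw [Nat.descFactorial_eq_factorial_mul_choose, Nat.descFactorial_eq_factorial_mul_choose,
    mul_assoc, mul_assoc] at h'
  exact Nat.le_of_mul_le_mul_left h' (Nat.factorial_pos k)

/-- If the complement of `W` of `M` elements contains few of the sets of size `k`, then a symmetrized
protocol hits any set of `W` differing indices. -/
theorem OneWayProtocol.IsSymmetrized.measureReal_miss_le {n k s : ℕ}
    {π : OneWayProtocol (urSubset n k) s} (hsym : π.IsSymmetrized) {δ ε : ℝ}
    (hfail : π.FailsWithProbAtMost δ) {x : Fin n → Bool} {b : (Fin n → Bool) × Fin (n + 1)}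
    (hxb : (urSubset n k).Promise x b) {S : Finset (Fin n)} (hS : S ⊆ diffIndices x b.1)
    (hε : 0 ≤ ε)
    (hmiss : (((diffIndices x b.1).card - S.card).choose (min k (diffIndices x b.1).card) : ℝ) ≤
      ε * ((diffIndices x b.1).card.choose (min k (diffIndices x b.1).card) : ℝ)) :
    π.μ.real (π.out x b ⁻¹' {A : Finset (Fin n) |
      ¬ ((urSubset n k).Correct x b A ∧ ∃ i ∈ S, i ∈ A)}) ≤ δ + ε := by
  set D := diffIndices x b.1 with hD
  set m := min k D.card with hm
  obtain ⟨A₀, hA₀, hA₀'⟩ := Finset.exists_subset_card_eq (min_le_right k D.card)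
  have hc₀ : (urSubset n k).Correct x b A₀ := ⟨hA₀, hA₀'⟩
  set q := π.μ.real {ω | π.out x b ω = A₀} with hq
  have hcorrect : ∀ A, A ∈ D.powersetCard m ↔ (urSubset n k).Correct x b A := fun A =>
    Finset.mem_powersetCard
  have hsum : ∀ F : Finset (Finset (Fin n)), F ⊆ D.powersetCard m →
      π.μ.real (π.out x b ⁻¹' (F : Set (Finset (Fin n)))) = F.card * q := by
    intro F hF
    have h₁ : π.out x b ⁻¹' (F : Set (Finset (Fin n))) = ⋃ A ∈ F, {ω | π.out x b ω = A} :=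
      Set.ext fun ω => by
        rw [Set.mem_iUnion₂]
        exact ⟨fun h => ⟨_, h, rfl⟩, fun ⟨_, hA, h⟩ => Set.mem_of_eq_of_mem (x := π.out x b ω) h hA⟩
    rw [h₁, measureReal_biUnion_finset, ← nsmul_eq_mul]
    · exact Finset.sum_eq_card_nsmul fun A hA => hsym x b hxb A A₀ ((hcorrect A).1 (hF hA)) hc₀
    · intro A _ B _ hAB
      exact Set.disjoint_left.2 fun ω h₁ h₂ => hAB (h₁.symm.trans h₂)
    · exact fun A _ => π.measurableSet_out x b {A}
  -- The correct outputs are disjoint events of common probability `q`.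
  have hall : (D.card.choose m : ℝ) * q ≤ 1 := by
    have h₂ := hsum _ subset_rfl
    rw [Finset.card_powersetCard] at h₂
    rw [← h₂]
    exact measureReal_le_one
  have hsub : (D \ S).powersetCard m ⊆ D.powersetCard m :=
    Finset.powersetCard_mono Finset.sdiff_subset
  have hG := hsum _ hsub
  rw [Finset.card_powersetCard, Finset.card_sdiff_of_subset hS] at hG
  have hsplit : π.out x b ⁻¹' {A : Finset (Fin n) |
      ¬ ((urSubset n k).Correct x b A ∧ ∃ i ∈ S, i ∈ A)} ⊆
      {ω | ¬ (urSubset n k).Correct x b (π.out x b ω)} ∪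
        π.out x b ⁻¹' (((D \ S).powersetCard m : Finset (Finset (Fin n))) : Set (Finset (Fin n))) := by
    intro ω hω
    by_cases hc : (urSubset n k).Correct x b (π.out x b ω)
    · refine Or.inr (Finset.mem_powersetCard.2 ⟨fun i hi => ?_, hc.2⟩)
      exact Finset.mem_sdiff.2 ⟨hc.1 hi, fun hiS => hω ⟨hc, i, hiS, hi⟩⟩
    · exact Or.inl hc
  refine (measureReal_mono hsplit).trans ((measureReal_union_le _ _).trans ?_)
  refine add_le_add (hfail x b hxb) ?_
  rw [hG]
  have hq0 : 0 ≤ q := measureReal_nonneg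
  nlinarith [mul_le_mul_of_nonneg_right hmiss hq0]

/-! ### The block encoding and its single query -/

section BlockEncoding

variable {n k T L : ℕ} {W : Fin T → ℕ}

/-- The `t`-th block of `L` bits of a string. -/
def bitBlock (z : Fin (T * L) → Bool) (t : Fin T) : Fin L → Bool :=
  fun l => z (finProdFinEquiv (t, l))

/-- Extend the bits after position `j` to a string. -/
def extendSuffix {N : ℕ} (b : Σ j : Fin N, ({i : Fin N // j < i} → Bool)) : Fin N → Bool :=
  fun i => if h : b.1 < i then b.2 ⟨i, h⟩ else false

/-- The places occupied by a string, block `t` occupying `W t` places that identify its content. -/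
def blockEmbedding (ι : (Σ t : Fin T, (Fin L → Bool) × Fin (W t)) ↪ Fin n)
    (z : Fin (T * L) → Bool) : (Σ t : Fin T, Fin (W t)) ↪ Fin n where
  toFun p := ι ⟨p.1, bitBlock z p.1, p.2⟩
  inj' := by
    rintro ⟨t, r⟩ ⟨t', r'⟩ h
    have h' := ι.injective h
    obtain rfl : t = t' := congrArg Sigma.fst h'
    simpa using h'

/-- The places occupied by those blocks of a string whose index satisfies `p`. -/
def blockSet (ι : (Σ t : Fin T, (Fin L → Bool) × Fin (W t)) ↪ Fin n) (p : Fin T → Prop)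
    [DecidablePred p] (z : Fin (T * L) → Bool) : Finset (Fin n) :=
  ((Finset.univ.filter p).sigma fun _ => Finset.univ).map (blockEmbedding ι z)

variable (ι : (Σ t : Fin T, (Fin L → Bool) × Fin (W t)) ↪ Fin n)

theorem card_blockSet (p : Fin T → Prop) [DecidablePred p] (z : Fin (T * L) → Bool) :
    (blockSet ι p z).card = ∑ t with p t, W t := by
  simp [blockSet]

variable {ι}

theorem mem_blockSet {p : Fin T → Prop} [DecidablePred p] {z : Fin (T * L) → Bool} {i : Fin n} :
    i ∈ blockSet ι p z ↔ ∃ t r, p t ∧ ι ⟨t, bitBlock z t, r⟩ = i := by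
  simp only [blockSet, Finset.mem_map, Finset.mem_sigma, Finset.mem_filter, Finset.mem_univ,
    true_and, and_true, Sigma.exists]
  exact exists_congr fun t => exists_congr fun r => Iff.rfl

theorem apply_mem_blockSet {p : Fin T → Prop} [DecidablePred p] {z : Fin (T * L) → Bool}
    {t : Fin T} {v : Fin L → Bool} {r : Fin (W t)} :
    ι ⟨t, v, r⟩ ∈ blockSet ι p z ↔ p t ∧ v = bitBlock z t := by
  rw [mem_blockSet]
  constructor
  · rintro ⟨t', r', hp, h⟩
    have h' := ι.injective h
    obtain rfl : t' = t := congrArg Sigma.fst h'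
    simp only [Sigma.mk.injEq, heq_eq_eq, true_and, Prod.mk.injEq] at h'
    exact ⟨hp, h'.1.symm⟩
  · rintro ⟨hp, rfl⟩
    exact ⟨t, r, hp, rfl⟩

theorem blockSet_congr {p : Fin T → Prop} [DecidablePred p] {z z' : Fin (T * L) → Bool}
    (h : ∀ t, p t → bitBlock z t = bitBlock z' t) : blockSet ι p z = blockSet ι p z' := by
  ext i
  simp only [mem_blockSet]
  constructor
  · rintro ⟨t, r, hp, rfl⟩
    exact ⟨t, r, hp, by rw [h t hp]⟩
  · rintro ⟨t, r, hp, rfl⟩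
    exact ⟨t, r, hp, by rw [h t hp]⟩

theorem blockSet_mono {p q : Fin T → Prop} [DecidablePred p] [DecidablePred q]
    {z : Fin (T * L) → Bool} (h : ∀ t, p t → q t) : blockSet ι p z ⊆ blockSet ι q z := by
  intro i
  simp only [mem_blockSet]
  rintro ⟨t, r, hp, rfl⟩
  exact ⟨t, r, h t hp, rfl⟩

/-- `finProdFinEquiv` numbers the bits block by block, so every bit of a later block lies after
Diane's position and the default `false` is never read. -/
theorem bitBlock_extendSuffix {z : Fin (T * L) → Bool}
    {b : Σ j : Fin (T * L), ({i : Fin (T * L) // j < i} → Bool)}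
    (h : (augIndex (T * L)).Promise z b) {t : Fin T} (ht : (finProdFinEquiv.symm b.1).1 < t) :
    bitBlock (extendSuffix b) t = bitBlock z t := by
  ext l
  have hlt : b.1 < finProdFinEquiv (t, l) := by
    obtain ⟨⟨t₀, l₀⟩, h₀⟩ := finProdFinEquiv.surjective b.1
    rw [← h₀, Equiv.symm_apply_apply] at ht
    rw [← h₀, Fin.lt_def]
    simp only [finProdFinEquiv_apply_val]
    have h₁ : L * (t₀ + 1 : ℕ) ≤ L * (t : ℕ) := Nat.mul_le_mul_left L ht
    have h₂ := l₀.2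
    rw [mul_add] at h₁
    omega
  rw [bitBlock, extendSuffix, dif_pos hlt]
  exact h ⟨_, hlt⟩

theorem bitSupport_decide_mem (A : Finset (Fin n)) : bitSupport (fun i => decide (i ∈ A)) = A := by
  ext i
  simp [bitSupport]

theorem diffIndices_blockSet (z : Fin (T * L) → Bool) (t : Fin T) :
    diffIndices (fun i => decide (i ∈ blockSet ι (fun _ => True) z))
      (fun i => decide (i ∈ blockSet ι (t < ·) z)) = blockSet ι (· ≤ t) z := by
  ext i
  simp only [diffIndices, Finset.mem_filter, Finset.mem_univ, true_and, ne_eq, decide_eq_decide]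
  have key : ∀ (q : Fin T → Prop) [DecidablePred q], i ∈ blockSet ι q z →
      ∃ u r, q u ∧ ι ⟨u, bitBlock z u, r⟩ = i := fun q _ h => mem_blockSet.1 h
  by_cases hi : i ∈ blockSet ι (fun _ => True) z
  · obtain ⟨u, r, -, rfl⟩ := key _ hi
    simp [apply_mem_blockSet]
  · have h₁ : i ∉ blockSet ι (t < ·) z := fun h => hi (blockSet_mono (fun _ _ => trivial) h)
    have h₂ : i ∉ blockSet ι (· ≤ t) z := fun h => hi (blockSet_mono (fun _ _ => trivial) h)
    simp [hi, h₁, h₂]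

theorem blockSet_lt_ssubset (z : Fin (T * L) → Bool) {t : Fin T} (ht : 0 < W t) :
    blockSet ι (t < ·) z ⊂ blockSet ι (fun _ => True) z := by
  refine Finset.ssubset_iff_subset_ne.2 ⟨blockSet_mono fun _ _ => trivial, fun he => ?_⟩
  have hmem : ι ⟨t, bitBlock z t, ⟨0, ht⟩⟩ ∈ blockSet ι (fun _ => True) z :=
    apply_mem_blockSet.2 ⟨trivial, rfl⟩
  rw [← he, apply_mem_blockSet] at hmem
  exact lt_irrefl _ hmem.1

theorem sum_le_of_embedding (z : Fin (T * L) → Bool)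
    (ι : (Σ t : Fin T, (Fin L → Bool) × Fin (W t)) ↪ Fin n) : ∑ t, W t ≤ n := by
  simpa using Fintype.card_le_of_embedding (blockEmbedding ι z)

/-- Charlie's string becomes the set of places it occupies, Diane's suffix the set of places occupied
by the blocks after the one that contains the wanted bit. -/
def blockQuery (k : ℕ) (ι : (Σ t : Fin T, (Fin L → Bool) × Fin (W t)) ↪ Fin n)
    (hW : ∀ t, 0 < W t) : SingleQuery (augIndex (T * L)) (urSubset n k) where
  encodeAlice z := fun i => decide (i ∈ blockSet ι (fun _ => True) z)
  encodeBob b :=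
    (fun i => decide (i ∈ blockSet ι ((finProdFinEquiv.symm b.1).1 < ·) (extendSuffix b)),
      ⟨∑ t, W t, Nat.lt_succ_of_le (sum_le_of_embedding (extendSuffix b) ι)⟩)
  decode := fun b (A : Finset (Fin n)) =>
    decide (∃ v r, ι ⟨(finProdFinEquiv.symm b.1).1, v, r⟩ ∈ A ∧
      v (finProdFinEquiv.symm b.1).2 = true)
  promise := fun (z : Fin (T * L) → Bool)
      (b : Σ j : Fin (T * L), ({i : Fin (T * L) // j < i} → Bool)) h => by
    change bitSupport (fun i => decide (i ∈ blockSet ι _ (extendSuffix b))) ⊂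
      bitSupport (fun i => decide (i ∈ blockSet ι _ z)) ∧
        ∑ t, W t = (bitSupport (fun i => decide (i ∈ blockSet ι _ z))).card
    rw [bitSupport_decide_mem, bitSupport_decide_mem, card_blockSet,
      blockSet_congr fun t ht => bitBlock_extendSuffix h ht]
    exact ⟨blockSet_lt_ssubset z (hW _), by simp⟩

/-- All indices of `A` in the region of block `t` carry the true content, so the existential in
`decode` is unambiguous once one such index exists. -/
theorem blockQuery_decode (ι : (Σ t : Fin T, (Fin L → Bool) × Fin (W t)) ↪ Fin n)
    (hW : ∀ t, 0 < W t) (z : Fin (T * L) → Bool)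
    (b : Σ j : Fin (T * L), ({i : Fin (T * L) // j < i} → Bool)) {A : Finset (Fin n)}
    (hsub : A ⊆ blockSet ι (· ≤ (finProdFinEquiv.symm b.1).1) z) {i : Fin n}
    (hi : i ∈ blockSet ι (· = (finProdFinEquiv.symm b.1).1) z) (hiA : i ∈ A) :
    (blockQuery k ι hW).decode b A = z b.1 := by
  have hz : z b.1 = bitBlock z (finProdFinEquiv.symm b.1).1 (finProdFinEquiv.symm b.1).2 := by
    rw [bitBlock, Prod.mk.eta, Equiv.apply_symm_apply]
  rw [hz]
  refine Bool.eq_iff_iff.2 (decide_eq_true_iff.trans ⟨?_, fun hl => ?_⟩)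
  · rintro ⟨v, r, hv, hvl⟩
    rw [← (apply_mem_blockSet.1 (hsub hv)).2]
    exact hvl
  · obtain ⟨u, r, hu, rfl⟩ := mem_blockSet.1 hi
    subst hu
    exact ⟨_, r, hiA, hl⟩

theorem failsWithProbAtMost_blockQuery
    (ι : (Σ t : Fin T, (Fin L → Bool) × Fin (W t)) ↪ Fin n) (hW : ∀ t, 0 < W t)
    (hmiss : ∀ t, 8 * (∑ u with u ≤ t, W u - W t).choose (min k (∑ u with u ≤ t, W u)) ≤
      (∑ u with u ≤ t, W u).choose (min k (∑ u with u ≤ t, W u)))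
    {s : ℕ} {π : OneWayProtocol (urSubset n k) s} (hfail : π.FailsWithProbAtMost (1 / 5))
    (hsym : π.IsSymmetrized) : ((blockQuery k ι hW).protocol π).FailsWithProbAtMost (1 / 3) := by
  intro (z : Fin (T * L) → Bool)
    (b : Σ j : Fin (T * L), ({i : Fin (T * L) // j < i} → Bool)) hzb
  set t := (finProdFinEquiv.symm b.1).1 with ht
  set x : Fin n → Bool := (blockQuery k ι hW).encodeAlice z with hx
  set y : (Fin n → Bool) × Fin (n + 1) := (blockQuery k ι hW).encodeBob b with hy
  have hdiff : diffIndices x y.1 = blockSet ι (· ≤ t) z := by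
    rw [← diffIndices_blockSet]
    refine congrArg (diffIndices x) (funext fun i => ?_)
    rw [← blockSet_congr fun u hu => bitBlock_extendSuffix hzb hu]
    rfl
  have hmain := hsym.measureReal_miss_le hfail ((blockQuery k ι hW).promise z b hzb)
    (S := blockSet ι (· = t) z) (ε := 1 / 8)
    (by
      change _ ⊆ diffIndices x y.1
      rw [hdiff]
      exact blockSet_mono fun _ h => h.le)
    (by norm_num)
    (by
      change (((diffIndices x y.1).card - _ : ℕ).choose (min k (diffIndices x y.1).card) : ℝ) ≤
        _ * ((diffIndices x y.1).card.choose (min k (diffIndices x y.1).card) : ℝ)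
      rw [hdiff, card_blockSet, card_blockSet, Finset.sum_filter (· = t), Finset.sum_ite_eq',
        if_pos (Finset.mem_univ t),
        one_div, inv_mul_eq_div, le_div_iff₀' (by norm_num)]
      exact_mod_cast hmiss t)
  refine ((measureReal_mono ?_).trans hmain).trans (by norm_num)
  intro ω hω hgood
  obtain ⟨⟨hsub, -⟩, i, hi, hiA⟩ := hgood
  exact hω (blockQuery_decode (k := k) ι hW z b (hsub.trans hdiff.subset) hi hiA)

end BlockEncoding

/-! ### Linear lower bound for augmented indexing -/

/-- The mistakes made on the string `z` when `g j` predicts bit `j` from the later bits. -/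
def predictionErrors {N : ℕ} (g : ∀ j : Fin N, ({i : Fin N // j < i} → Bool) → Bool)
    (z : Fin N → Bool) : Fin N → Bool :=
  fun j => z j ^^ g j (fun i => z i)

/-- A string can be recovered from the mistakes of a predictor, from the last bit to the first. -/
theorem predictionErrors_injective {N : ℕ}
    (g : ∀ j : Fin N, ({i : Fin N // j < i} → Bool) → Bool) :
    Function.Injective (predictionErrors g) := by
  intro z z' h
  by_contra hne
  -- At the last position of disagreement the predictor sees equal suffixes, so exactly one of the
  -- two predictions is wrong.
  obtain ⟨j, hj, hmax⟩ := (Set.toFinite {j | z j ≠ z' j}).exists_maximal (Function.ne_iff.1 hne)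
  have hlater : (fun i : {i : Fin N // j < i} => z i) = fun i : {i : Fin N // j < i} => z' i := by
    ext i
    by_contra hi
    exact absurd (hmax hi i.2.le) (not_le.2 i.2)
  have hj' := congrFun h j
  simp only [predictionErrors, hlater] at hj'
  exact hj (Bool.xor_left_inj.1 hj')

/-- Every error pattern arises from exactly one string, so the sum factors over the bits. -/
theorem sum_pow_predictionErrors {N : ℕ}
    (g : ∀ j : Fin N, ({i : Fin N // j < i} → Bool) → Bool) (a : ℝ) :
    ∑ z, ∏ j, (if predictionErrors g z j then a else 1) = (a + 1) ^ N := by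
  have hb := (Finite.injective_iff_bijective.1 (predictionErrors_injective g))
  rw [Function.Bijective.sum_comp hb (fun e : Fin N → Bool => ∏ j, (if e j then a else 1)),
    ← Fintype.prod_sum (fun (_ : Fin N) (c : Bool) => if c = true then a else 1)]
  simp

/-- Averaging over the coins, with Diane given the true suffix of `z` at each of the `N` positions.
-/
theorem augIndex_exists_good_randomness {N s : ℕ} {π : OneWayProtocol (augIndex N) s} {δ : ℝ}
    (h : π.FailsWithProbAtMost δ) :
    ∃ ω, ∑ z : Fin N → Bool, ∑ j : Fin N,
      (if predictionErrors (fun j w => π.bob ω (π.alice ω z) ⟨j, w⟩) z j then (1 : ℝ) else 0) ≤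
        2 ^ N * (N * δ) := by
  set E : (Fin N → Bool) → Fin N → Set π.Ω := fun z j =>
    π.out z ⟨j, fun i => z i⟩ ⁻¹' {o | ¬ (augIndex N).Correct z ⟨j, fun i => z i⟩ o} with hE
  have hmeas : ∀ z j, MeasurableSet (E z j) := fun z j => π.measurableSet_out z _ _
  have heq : ∀ (z : Fin N → Bool) (j : Fin N),
      (fun ω => if predictionErrors (fun j w => π.bob ω (π.alice ω z) ⟨j, w⟩) z j
        then (1 : ℝ) else 0) = (E z j).indicator 1 := by
    intro z j
    ext ω
    have hxor : predictionErrors (fun j w => π.bob ω (π.alice ω z) ⟨j, w⟩) z j = true ↔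
        ω ∈ E z j :=
      Bool.xor_iff_ne.trans ne_comm
    by_cases hω : ω ∈ E z j
    · rw [if_pos (hxor.2 hω), Set.indicator_of_mem hω, Pi.one_apply]
    · rw [if_neg (fun hc => hω (hxor.1 hc)), Set.indicator_of_notMem hω]
  have hint : ∀ (z : Fin N → Bool) (j : Fin N),
      Integrable (fun ω => if predictionErrors (fun j w => π.bob ω (π.alice ω z) ⟨j, w⟩) z j
        then (1 : ℝ) else 0) π.μ := by
    intro z j
    rw [heq]
    exact (integrable_const (1 : ℝ)).indicator (hmeas z j)
  obtain ⟨ω, hω⟩ := exists_le_integral (μ := π.μ)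
    (integrable_finsetSum Finset.univ fun z _ => integrable_finsetSum Finset.univ fun j _ => hint z j)
  refine ⟨ω, hω.trans ?_⟩
  rw [integral_finsetSum _ fun z _ => integrable_finsetSum Finset.univ fun j _ => hint z j]
  refine (Finset.sum_le_card_nsmul _ _ (N * δ) fun z _ => ?_).trans_eq (by simp)
  rw [integral_finsetSum _ fun j _ => hint z j]
  refine (Finset.sum_le_card_nsmul _ _ δ fun j _ => ?_).trans_eq (by simp)
  rw [heq, integral_indicator_one (hmeas z j)]
  exact h z ⟨j, fun i => z i⟩ fun _ => rfl

/-- Both sides bound `∑ z, 2 ^ (-e z)`. From above, replace the message of `z` by a sum over all `2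
^ s` messages, each contributing `(1 + 1 / 2) ^ N`. From below, use convexity and the mean bound `N
* δ` on `e`. -/
theorem augIndex_two_pow_le {N s : ℕ} {π : OneWayProtocol (augIndex N) s} {δ : ℝ}
    (h : π.FailsWithProbAtMost δ) :
    (2 : ℝ) ^ N * Real.exp (-(Real.log 2 * (N * δ))) ≤ 2 ^ s * (3 / 2) ^ N := by
  obtain ⟨ω, hω⟩ := augIndex_exists_good_randomness h
  let g : (Fin s → Bool) → ∀ j : Fin N, ({i : Fin N // j < i} → Bool) → Bool :=
    fun m j w => π.bob ω m ⟨j, w⟩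
  set e : (Fin N → Bool) → ℝ := fun z => ∑ j : Fin N,
    (if predictionErrors (g (π.alice ω z)) z j then (1 : ℝ) else 0) with he
  replace hω : ∑ z, e z ≤ 2 ^ N * (N * δ) := hω
  set a : ℝ := N * δ with ha
  have hprod : ∀ z, Real.exp (-(Real.log 2 * e z)) =
      ∏ j, (if predictionErrors (g (π.alice ω z)) z j then (1 / 2 : ℝ) else 1) := by
    intro z
    rw [he, Finset.mul_sum, ← Finset.sum_neg_distrib, Real.exp_sum]
    refine Finset.prod_congr rfl fun j _ => ?_
    split_ifs
    · rw [mul_one, Real.exp_neg, Real.exp_log two_pos, one_div]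
    · simp
  have hupper : ∑ z, Real.exp (-(Real.log 2 * e z)) ≤ 2 ^ s * (3 / 2) ^ N := by
    calc ∑ z, Real.exp (-(Real.log 2 * e z))
        ≤ ∑ z, ∑ m, ∏ j, (if predictionErrors (g m) z j then (1 / 2 : ℝ) else 1) := by
          refine Finset.sum_le_sum fun z _ => ?_
          rw [hprod]
          refine Finset.single_le_sum (f := fun m => ∏ j,
            (if predictionErrors (g m) z j then (1 / 2 : ℝ) else 1)) (fun m _ => ?_)
            (Finset.mem_univ _)
          exact Finset.prod_nonneg fun j _ => by split_ifs <;> norm_num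
      _ = ∑ m : Fin s → Bool, (3 / 2 : ℝ) ^ N := by
          rw [Finset.sum_comm]
          refine Finset.sum_congr rfl fun m _ => ?_
          rw [sum_pow_predictionErrors]
          norm_num
      _ = 2 ^ s * (3 / 2) ^ N := by simp
  refine le_trans ?_ hupper
  -- Jensen's inequality by hand: the tangent of the exponential at the mean bound `a`.
  have htangent : ∀ z, Real.exp (-(Real.log 2 * a)) * (1 + Real.log 2 * (a - e z)) ≤
      Real.exp (-(Real.log 2 * e z)) := by
    intro z
    have h₁ : Real.exp (-(Real.log 2 * e z)) =
        Real.exp (-(Real.log 2 * a)) * Real.exp (Real.log 2 * (a - e z)) := by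
      rw [← Real.exp_add]
      ring_nf
    rw [h₁]
    refine mul_le_mul_of_nonneg_left ?_ (Real.exp_pos _).le
    linarith [Real.add_one_le_exp (Real.log 2 * (a - e z))]
  refine le_trans ?_ (Finset.sum_le_sum fun z _ => htangent z)
  rw [← Finset.mul_sum, Finset.sum_add_distrib, ← Finset.mul_sum, Finset.sum_sub_distrib]
  have hlog : 0 ≤ Real.log 2 := Real.log_nonneg one_le_two
  have hpos := Real.exp_pos (-(Real.log 2 * a))
  have hcard : ∑ _z : Fin N → Bool, (1 : ℝ) = 2 ^ N := by simp
  have hcard' : ∑ _z : Fin N → Bool, a = 2 ^ N * a := by simp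
  rw [hcard, hcard', mul_comm]
  refine mul_le_mul_of_nonneg_left ?_ hpos.le
  nlinarith

/-- Augmented indexing with failure probability `1 / 3` needs a message of linear length. -/
theorem augIndex_le_fifteen_mul {N s : ℕ} {π : OneWayProtocol (augIndex N) s}
    (h : π.FailsWithProbAtMost (1 / 3)) : N ≤ 15 * s := by
  have h₁ := augIndex_two_pow_le h
  have h₂ : Real.exp (-(Real.log 2 * (N * (1 / 3)))) ^ 3 * 2 ^ N = 1 := by
    rw [← Real.exp_nat_mul, ← Real.exp_log (two_pos : (0 : ℝ) < 2), ← Real.exp_nat_mul,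
      ← Real.exp_add, Real.exp_eq_one_iff, Real.log_exp]
    push_cast
    ring
  have h₃ : ((2 : ℝ) ^ N) ^ 3 ≤ (2 ^ s * (3 / 2) ^ N) ^ 3 * 2 ^ N := by
    calc ((2 : ℝ) ^ N) ^ 3
        = (2 ^ N * Real.exp (-(Real.log 2 * (N * (1 / 3))))) ^ 3 * 2 ^ N := by
          rw [mul_pow, mul_assoc, h₂, mul_one]
      _ ≤ _ := by gcongr
  have h₄ : (2 : ℝ) ^ (5 * N) ≤ 2 ^ (3 * s) * 3 ^ (3 * N) := by
    have h₅ : (2 : ℝ) ^ (5 * N) = ((2 : ℝ) ^ N) ^ 3 * (2 ^ N) ^ 2 := by ring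
    rw [h₅, div_pow] at *
    refine (mul_le_mul_of_nonneg_right h₃ (by positivity)).trans_eq ?_
    field_simp
    ring
  -- Fifth powers let `3 ^ 5 = 243 ≤ 2 ^ 8` replace an estimate of `log 3`.
  have h₆ : (2 : ℝ) ^ (25 * N) ≤ 2 ^ (15 * s + 24 * N) := by
    calc (2 : ℝ) ^ (25 * N) = (2 ^ (5 * N)) ^ 5 := by ring
      _ ≤ (2 ^ (3 * s) * 3 ^ (3 * N)) ^ 5 := by gcongr
      _ = 2 ^ (15 * s) * (243 : ℝ) ^ (3 * N) := by
          rw [mul_pow, ← pow_mul, ← pow_mul, show (243 : ℝ) = 3 ^ 5 by norm_num, ← pow_mul]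
          ring_nf
      _ ≤ 2 ^ (15 * s) * (256 : ℝ) ^ (3 * N) := by gcongr; norm_num
      _ = 2 ^ (15 * s + 24 * N) := by
          rw [pow_add, show (256 : ℝ) = 2 ^ 8 by norm_num, ← pow_mul]
          ring_nf
  have := (pow_le_pow_iff_right₀ (one_lt_two : (1 : ℝ) < 2)).1 h₆
  omega

/-! ### Block sizes that are hit with probability at least 7/8 -/

theorem eight_mul_choose_le_of_le {M W k : ℕ} (hW : 0 < W) (hWM : W ≤ M) (hM : M ≤ k) :
    8 * (M - W).choose (min k M) ≤ M.choose (min k M) := by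
  rw [min_eq_right hM, Nat.choose_eq_zero_of_lt (by omega)]
  simp

theorem eight_mul_choose_le_of_pow_le {M W k : ℕ} (hW : 0 < W) (hWM : W ≤ M)
    (h : 8 * (M - W) ^ k ≤ M ^ k) :
    8 * (M - W).choose (min k M) ≤ M.choose (min k M) := by
  rcases le_total M k with hM | hM
  · exact eight_mul_choose_le_of_le hW hWM hM
  rw [min_eq_left hM]
  refine Nat.le_of_mul_le_mul_right (c := M ^ k) ?_ (pow_pos (by omega) k)
  calc 8 * (M - W).choose k * M ^ k = 8 * ((M - W).choose k * M ^ k) := mul_assoc _ _ _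
    _ ≤ 8 * (M.choose k * (M - W) ^ k) := Nat.mul_le_mul_left 8 (Nat.choose_sub_mul_pow_le M W k)
    _ = M.choose k * (8 * (M - W) ^ k) := by ring
    _ ≤ M.choose k * M ^ k := Nat.mul_le_mul_left _ h

theorem eight_mul_sub_pow_le {M W k : ℕ} (hk : 1 ≤ k) (h : 7 * M ≤ 8 * W) :
    8 * (M - W) ^ k ≤ M ^ k := by
  obtain ⟨j, rfl⟩ := Nat.exists_eq_add_of_le' hk
  calc 8 * (M - W) ^ (j + 1) = (M - W) ^ j * (8 * (M - W)) := by ring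
    _ ≤ M ^ j * M := Nat.mul_le_mul (Nat.pow_le_pow_left (Nat.sub_le M W) j) (by omega)
    _ = M ^ (j + 1) := (pow_succ M j).symm

/-- With `u = W / M`, `(1 - u) ^ k * (1 + u) ^ k ≤ 1`, and Bernoulli gives `(1 + u) ^ k ≥ 1 + k * u
≥ 8`. -/
theorem eight_mul_sub_pow_le_of_mul_le {M W k : ℕ} (hM : 0 < M)
    (h : 7 * M ≤ k * W) : 8 * (M - W) ^ k ≤ M ^ k := by
  have hMr : (0 : ℝ) < M := by exact_mod_cast hM
  have h₁ : (8 : ℝ) * (M : ℝ) ^ k ≤ (M + W : ℝ) ^ k := by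
    have hb := one_add_mul_le_pow (a := (W : ℝ) / M)
      (by linarith [show (0 : ℝ) ≤ W / M by positivity]) k
    have h7 : (7 : ℝ) ≤ k * (W / M) := by
      rw [← mul_div_assoc, le_div_iff₀ hMr]
      exact_mod_cast h
    have heq : (M + W : ℝ) ^ k = (1 + (W : ℝ) / M) ^ k * (M : ℝ) ^ k := by
      rw [← mul_pow]
      congr 1
      field_simp
    rw [heq]
    exact mul_le_mul_of_nonneg_right (by linarith) (by positivity)
  have h₂ : 8 * M ^ k ≤ (M + W) ^ k := by exact_mod_cast h₁
  refine Nat.le_of_mul_le_mul_right (c := M ^ k) ?_ (pow_pos hM k)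
  calc 8 * (M - W) ^ k * M ^ k = (M - W) ^ k * (8 * M ^ k) := by ring
    _ ≤ (M - W) ^ k * (M + W) ^ k := Nat.mul_le_mul_left _ h₂
    _ = ((M + W) * (M - W)) ^ k := by rw [mul_pow, mul_comm]
    _ ≤ (M * M) ^ k := by
      refine Nat.pow_le_pow_left ?_ k
      rw [← Nat.mul_self_sub_mul_self_eq]
      exact Nat.sub_le _ _
    _ = M ^ k * M ^ k := mul_pow _ _ _

theorem seven_mul_sum_pow_div_le {κ : ℕ} (hκ : 0 < κ) (B : ℕ) :
    7 * ∑ i ∈ Finset.range (κ * B), 8 ^ (i / κ) ≤ κ * 8 ^ B := by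
  induction B with
  | zero => simp
  | succ B ih =>
    rw [mul_add, mul_one, Finset.sum_range_add]
    have h : ∑ i ∈ Finset.range κ, 8 ^ ((κ * B + i) / κ) = κ * 8 ^ B := by
      rw [Finset.sum_congr rfl (g := fun _ => 8 ^ B)]
      · simp
      · intro i hi
        rw [Nat.mul_add_div hκ, Nat.div_eq_of_lt (Finset.mem_range.1 hi), add_zero]
    rw [h, pow_succ]
    linarith

/-- Complete the sum to the end of the size level of `t`; the geometric series of ratio 8 is at most
8/7 of its last level. -/
theorem seven_mul_sum_filter_le {κ T : ℕ} (hκ : 0 < κ) (t : Fin T) :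
    7 * ∑ u : Fin T with u ≤ t, 8 ^ ((u : ℕ) / κ) ≤ 8 * (κ * 8 ^ ((t : ℕ) / κ)) := by
  have h₁ : ∑ u : Fin T with u ≤ t, 8 ^ ((u : ℕ) / κ) ≤
      ∑ i ∈ Finset.range (κ * ((t : ℕ) / κ + 1)), 8 ^ (i / κ) := by
    rw [Finset.sum_filter]
    simp only [Fin.le_def]
    rw [Fin.sum_univ_eq_sum_range (fun i => if i ≤ (t : ℕ) then 8 ^ (i / κ) else 0),
      ← Finset.sum_filter]
    refine Finset.sum_le_sum_of_subset fun i hi => ?_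
    have := Nat.lt_mul_div_succ (t : ℕ) hκ
    exact Finset.mem_range.2 ((Finset.mem_filter.1 hi).2.trans_lt this)
  have h₂ := seven_mul_sum_pow_div_le hκ ((t : ℕ) / κ + 1)
  rw [pow_succ] at h₂
  linarith

/-- Sizes of blocks for which augmented indexing on `T * L` bits embeds into `urSubset n k`. -/
structure AdmissibleBlocks (n k T L : ℕ) (W : Fin T → ℕ) : Prop where
  pos : ∀ t, 0 < W t
  fits : 2 ^ L * ∑ t, W t ≤ n
  hits : ∀ t, 8 * (∑ u with u ≤ t, W u - W t).choose (min k (∑ u with u ≤ t, W u)) ≤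
    (∑ u with u ≤ t, W u).choose (min k (∑ u with u ≤ t, W u))

theorem AdmissibleBlocks.exists_singleQuery {n k T L : ℕ} {W : Fin T → ℕ}
    (h : AdmissibleBlocks n k T L W) :
    ∃ r : SingleQuery (augIndex (T * L)) (urSubset n k),
      ∀ (s : ℕ) (π : OneWayProtocol (urSubset n k) s), π.FailsWithProbAtMost (1 / 5) →
        ∃ π' : OneWayProtocol (urSubset n k) s,
          π'.FailsWithProbAtMost (1 / 5) ∧ π'.IsSymmetrized ∧
          (r.protocol π').FailsWithProbAtMost (1 / 3) := by
  obtain ⟨ι⟩ : Nonempty ((Σ t : Fin T, (Fin L → Bool) × Fin (W t)) ↪ Fin n) := by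
    refine Function.Embedding.nonempty_of_card_le ?_
    simpa [← Finset.mul_sum] using h.fits
  refine ⟨blockQuery k ι h.pos, fun s π hπ => ⟨π.symmetrize,
    OneWayProtocol.failsWithProbAtMost_symmetrize hπ, π.isSymmetrized_symmetrize, ?_⟩⟩
  exact failsWithProbAtMost_blockQuery ι h.pos h.hits
    (OneWayProtocol.failsWithProbAtMost_symmetrize hπ) π.isSymmetrized_symmetrize

theorem le_sum_filter_le {T : ℕ} (W : Fin T → ℕ) (t : Fin T) : W t ≤ ∑ u with u ≤ t, W u :=
  Finset.single_le_sum (f := W) (fun _ _ => Nat.zero_le _)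
    (Finset.mem_filter.2 ⟨Finset.mem_univ t, le_rfl⟩)

theorem admissibleBlocks_one {n k T : ℕ} (hk : T ≤ k) (hn : 2 * T ≤ n) :
    AdmissibleBlocks n k T 1 (fun _ => 1) where
  pos _ := one_pos
  fits := by simpa using hn
  hits t := by
    refine eight_mul_choose_le_of_le one_pos (le_sum_filter_le (fun _ => 1) t) ?_
    refine le_trans ?_ hk
    simpa using Finset.card_filter_le (Finset.univ : Finset (Fin T)) (· ≤ t)

theorem admissibleBlocks_geometric {n k q : ℕ} (hk : 1 ≤ k) (hn : k * 2 ^ (4 * q) ≤ n) :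
    AdmissibleBlocks n k (max 1 (k / 8) * q) q (fun t => 8 ^ ((t : ℕ) / max 1 (k / 8))) where
  pos _ := by positivity
  fits := by
    have hκ : 0 < max 1 (k / 8) := by omega
    have hκk : max 1 (k / 8) ≤ k := by omega
    rw [Fin.sum_univ_eq_sum_range (fun i => 8 ^ (i / max 1 (k / 8)))]
    have h := seven_mul_sum_pow_div_le hκ q
    calc 2 ^ q * ∑ i ∈ Finset.range (max 1 (k / 8) * q), 8 ^ (i / max 1 (k / 8))
        ≤ 2 ^ q * (max 1 (k / 8) * 8 ^ q) := Nat.mul_le_mul_left _ (by omega)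
      _ ≤ 2 ^ q * (k * 8 ^ q) := by gcongr
      _ = k * 2 ^ (4 * q) := by
        rw [show (8 : ℕ) = 2 ^ 3 by norm_num, ← pow_mul]
        ring
      _ ≤ n := hn
  hits t := by
    have hκ : 0 < max 1 (k / 8) := by omega
    have hpos : 0 < 8 ^ ((t : ℕ) / max 1 (k / 8)) := by positivity
    have hle := le_sum_filter_le (fun t : Fin (max 1 (k / 8) * q) =>
      8 ^ ((t : ℕ) / max 1 (k / 8))) t
    have h := seven_mul_sum_filter_le hκ t
    refine eight_mul_choose_le_of_pow_le hpos hle ?_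
    -- For `k < 16` there is one block per level, and it holds 7/8 of the total. Otherwise `8 * (k /
    -- 8) ≤ k`, which Bernoulli's bound needs.
    rcases lt_or_ge k 16 with hk' | hk'
    · refine eight_mul_sub_pow_le hk (h.trans ?_)
      have h1 : max 1 (k / 8) ≤ 1 := by omega
      exact Nat.mul_le_mul_left 8 ((Nat.mul_le_mul_right _ h1).trans_eq (one_mul _))
    · refine eight_mul_sub_pow_le_of_mul_le (hpos.trans_le hle) (h.trans ?_)
      rw [← mul_assoc]
      exact Nat.mul_le_mul_right _ (by omega)

theorem exists_admissibleBlocks {n k : ℕ} (hk : 1 ≤ k) (hkn : k ≤ n) :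
    ∃ (T L : ℕ) (W : Fin T → ℕ), AdmissibleBlocks n k T L W ∧
      1 / 1024 * ((k : ℝ) * (Real.logb 2 ((n : ℝ) / (k : ℝ))) ^ 2) ≤ ((T * L : ℕ) : ℝ) ∧
      T * L ≤ ⌈1 * ((k : ℝ) * (Real.logb 2 ((n : ℝ) / (k : ℝ))) ^ 2)⌉₊ := by
  have hk0 : (0 : ℝ) < k := by exact_mod_cast hk
  have hdiv : (1 : ℝ) ≤ n / k := by
    rw [one_le_div hk0]
    exact_mod_cast hkn
  have hlog0 : 0 ≤ Real.logb 2 ((n : ℝ) / k) := Real.logb_nonneg one_lt_two hdiv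
  have hupper : ∀ m : ℕ, n < k * 2 ^ m → Real.logb 2 ((n : ℝ) / k) < m := by
    intro m hm
    rw [Real.logb_lt_iff_lt_rpow one_lt_two (by linarith), Real.rpow_natCast, div_lt_iff₀' hk0]
    exact_mod_cast hm
  rcases lt_or_ge n (k * 2 ^ 4) with h | h
  · set X : ℝ := (k : ℝ) * (Real.logb 2 ((n : ℝ) / (k : ℝ))) ^ 2 with hX
    have hX16 : X ≤ 16 * k := by
      have h4 := hupper 4 h
      push_cast at h4
      have hsq := pow_le_pow_left₀ hlog0 h4.le 2
      rw [hX, mul_comm]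
      exact mul_le_mul_of_nonneg_right (hsq.trans (by norm_num)) hk0.le
    have hXn : X ≤ 1024 * ((n / 2 : ℕ) : ℝ) := by
      rcases Nat.lt_or_ge n 2 with hn | hn
      · obtain rfl : n = 1 := by omega
        obtain rfl : k = 1 := by omega
        simp [hX]
      · have : (k : ℝ) ≤ 3 * ((n / 2 : ℕ) : ℝ) := by
          have : k ≤ 3 * (n / 2) := by omega
          exact_mod_cast this
        linarith
    -- The ceiling keeps the upper bound when `n` is close to `k`; for `n = k` it makes `T = 0`.
    refine ⟨min k (min (n / 2) ⌈1 * X⌉₊), 1, _, admissibleBlocks_one (min_le_left _ _) ?_, ?_, ?_⟩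
    · omega
    · rw [mul_one, Nat.cast_min, Nat.cast_min]
      have hX0 : 0 ≤ X := by positivity
      refine le_min (by linarith) (le_min (by linarith) ?_)
      have := Nat.le_ceil (1 * X)
      linarith
    · rw [mul_one]
      exact (min_le_right _ _).trans (min_le_right _ _)
  · set l := Nat.log 2 (n / k) with hl
    have hne : n / k ≠ 0 := (Nat.div_pos hkn hk).ne'
    have hl4 : 4 ≤ l := Nat.le_log_of_pow_le one_lt_two
      ((Nat.le_div_iff_mul_le hk).2 (by linarith))
    have hlow : k * 2 ^ l ≤ n := by
      rw [mul_comm]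
      exact (Nat.le_div_iff_mul_le hk).1 (Nat.pow_log_le_self 2 hne)
    have hhigh : n < k * 2 ^ (l + 1) := by
      rw [mul_comm]
      exact (Nat.div_lt_iff_lt_mul hk).1 (Nat.lt_pow_succ_log_self one_lt_two _)
    have hlog : (l : ℝ) ≤ Real.logb 2 ((n : ℝ) / k) := by
      rw [Real.le_logb_iff_rpow_le one_lt_two (by linarith), Real.rpow_natCast, le_div_iff₀' hk0]
      exact_mod_cast hlow
    have hlog' := hupper _ hhigh
    -- Here `2 ^ (4 * q) ≤ n / k`, and `l ≥ 4` makes `q = l / 4` positive. The losses `16` in `k`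
    -- and `8 ^ 2` in the squared logarithm give `1024`.
    refine ⟨_, l / 4, _, admissibleBlocks_geometric (q := l / 4) hk
      ((Nat.mul_le_mul_left k (Nat.pow_le_pow_right two_pos (by omega))).trans hlow), ?_, ?_⟩
    · have h₁ : Real.logb 2 ((n : ℝ) / k) ≤ 8 * ((l / 4 : ℕ) : ℝ) := by
        refine hlog'.le.trans ?_
        have : l + 1 ≤ 8 * (l / 4) := by omega
        exact_mod_cast this
      have h₂ : (k : ℝ) ≤ 16 * ((max 1 (k / 8) : ℕ) : ℝ) := by
        have : k ≤ 16 * max 1 (k / 8) := by omega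
        exact_mod_cast this
      have h₃ : (k : ℝ) * (Real.logb 2 ((n : ℝ) / k)) ^ 2 ≤
          (16 * ((max 1 (k / 8) : ℕ) : ℝ)) * (8 * ((l / 4 : ℕ) : ℝ)) ^ 2 := by gcongr
      rw [Nat.cast_mul, Nat.cast_mul]
      linarith
    · have h₁ : ((l / 4 : ℕ) : ℝ) ≤ Real.logb 2 ((n : ℝ) / k) := by
        refine le_trans ?_ hlog
        exact_mod_cast Nat.div_le_self l 4
      have h₂ : ((max 1 (k / 8) : ℕ) : ℝ) ≤ k := by
        have : max 1 (k / 8) ≤ k := by omega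
        exact_mod_cast this
      have h₃ : ((max 1 (k / 8) * (l / 4) * (l / 4) : ℕ) : ℝ) ≤
          1 * ((k : ℝ) * (Real.logb 2 ((n : ℝ) / k)) ^ 2) := by
        rw [Nat.cast_mul, Nat.cast_mul, mul_assoc, ← sq, one_mul]
        gcongr
      exact_mod_cast h₃.trans (Nat.le_ceil _)

/-! ### Conclusion -/

theorem exists_protocol_oneWayComplexity (n k : ℕ) :
    ∃ π : OneWayProtocol (urSubset n k) (oneWayComplexity (1 / 5) (urSubset n k)),
      π.FailsWithProbAtMost (1 / 5) := by
  obtain ⟨π, hπ⟩ := urSubset_solvable n k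
  exact Nat.sInf_mem (s := {s | ∃ π : OneWayProtocol (urSubset n k) s,
    π.FailsWithProbAtMost (1 / 5)}) ⟨n, π, hπ.mono (by norm_num)⟩

theorem mainTheorem6 :
    (∃ c₁ c₂ : ℝ, 0 < c₁ ∧ 0 < c₂ ∧ ∀ n k : ℕ, 1 ≤ k → k ≤ n →
      ∃ N : ℕ,
        c₁ * ((k : ℝ) * (Real.logb 2 ((n : ℝ) / (k : ℝ))) ^ 2) ≤ (N : ℝ) ∧
        N ≤ ⌈c₂ * ((k : ℝ) * (Real.logb 2 ((n : ℝ) / (k : ℝ))) ^ 2)⌉₊ ∧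
        (∃ r : SingleQuery (augIndex N) (urSubset n k),
          ∀ (s : ℕ) (π : OneWayProtocol (urSubset n k) s), π.FailsWithProbAtMost (1 / 5) →
            ∃ π' : OneWayProtocol (urSubset n k) s,
              π'.FailsWithProbAtMost (1 / 5) ∧ π'.IsSymmetrized ∧
              (r.protocol π').FailsWithProbAtMost (1 / 3)) ∧
        oneWayComplexity (1 / 3) (augIndex N) ≤ oneWayComplexity (1 / 5) (urSubset n k)) ∧
    (∃ c : ℝ, 0 < c ∧ ∀ n k : ℕ, 1 ≤ k → k ≤ n →
      c * min (n : ℝ) ((k : ℝ) * (Real.logb 2 ((n : ℝ) / (k : ℝ))) ^ 2) ≤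
        (oneWayComplexity (1 / 5) (urSubset n k) : ℝ)) := by
  refine ⟨⟨1 / 1024, 1, by norm_num, one_pos, fun n k hk hkn => ?_⟩,
    -- `15360 = 15 * 1024`: the loss for augmented indexing times the loss in `N`.
    1 / 15360, by norm_num, fun n k hk hkn => ?_⟩
  · obtain ⟨T, L, W, hW, hlow, hup⟩ := exists_admissibleBlocks hk hkn
    obtain ⟨r, hr⟩ := hW.exists_singleQuery
    refine ⟨T * L, hlow, hup, ⟨r, hr⟩, ?_⟩
    obtain ⟨π, hπ⟩ := exists_protocol_oneWayComplexity n k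
    obtain ⟨π', -, -, hπ'⟩ := hr _ π hπ
    exact Nat.sInf_le ⟨r.protocol π', hπ'⟩
  · obtain ⟨T, L, W, hW, hlow, -⟩ := exists_admissibleBlocks hk hkn
    obtain ⟨r, hr⟩ := hW.exists_singleQuery
    obtain ⟨π, hπ⟩ := exists_protocol_oneWayComplexity n k
    obtain ⟨π', -, -, hπ'⟩ := hr _ π hπ
    have hN : ((T * L : ℕ) : ℝ) ≤ 15 * (oneWayComplexity (1 / 5) (urSubset n k) : ℝ) := by
      exact_mod_cast augIndex_le_fifteen_mul hπ'
    -- The bound holds for the second term alone, hence for the minimum.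
    have hmin := min_le_right (n : ℝ) ((k : ℝ) * (Real.logb 2 ((n : ℝ) / (k : ℝ))) ^ 2)
    linarith
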